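/- Let $0<q<1$ and write $(x;q)_n=\prod_{k=0}^{n-1}(1-xq^k)$, $(x;q)_\infty=\prod_{k=0}^{\infty}(1-xq^k)$, $(x,y;q)_n=(x;q)_n(y;q)_n$ (also for $n=\infty$), and $$T_n(q)=\sum_{j=0}^{n}q^{-j(j+1)/2}.$$ Let $a,b$ be complex numbers with $|ab/q|<1$ such that $aq^k\neq 1$ and $bq^k\ne 1$ for all integers $k\ge 0$. If $a=0$, the product $(q/a;q)_n\,a^n$ is read as its limit $(-1)^nq^{n(n+1)/2}$ as $a\to0$, and likewise for $b$. Then all the series below converge absolutely, and $$\frac{(q,ab/q;q)_\infty}{(a,b;q)_\infty}\sum_{n=0}^\infty\frac{(-q;q)_n^2\,(q/a,q/b;q)_n\,(ab/q)^n}{(q;q)_{2n}} =1+\sum_{n=1}^\infty(1+q^n)\frac{(q/a,q/b;q)_n\,(ab)^n}{(a,b;q)_n}\,q^{n^2-2n}\bigl(q^nT_n(q)-T_{n-1}(q)\bigr)$$ and $$\frac{(q,ab/q;q)_\infty}{(a,b;q)_\infty}\sum_{n=0}^\infty\frac{(q/a,q/b;q)_n\,(ab/q)^n}{(q;q^2)_{n}}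 =1+\sum_{n=1}^\infty(1+q^n)\frac{(q/a,q/b;q)_n\,(-ab)^n}{(a,b;q)_n}\,q^{n^2-2n}\bigl(q^nT_n(q)-T_{n-1}(q)\bigr).$$ -/

import Mathlib

/-- The finite `q`-shifted factorial `(a; q)_n = ∏_{k=0}^{n-1} (1 - a q^k)`. -/
noncomputable def qPoch (a q : ℂ) (n : ℕ) : ℂ :=
  ∏ k ∈ Finset.range n, (1 - a * q ^ k)

/-- The infinite `q`-shifted factorial `(a; q)_∞ = ∏_{k=0}^∞ (1 - a q^k)`. -/
noncomputable def qPochInf (a q : ℂ) : ℂ :=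
  ∏' k : ℕ, (1 - a * q ^ k)

/-- For `|q| < 1` the product defining `(a; q)_∞` converges. -/
theorem multipliable_qPochInf (a q : ℂ) (hq : ‖q‖ < 1) :
    Multipliable (fun k : ℕ => 1 - a * q ^ k) := by
  have h : Summable (fun k : ℕ => ‖-(a * q ^ k)‖) := by
    simp only [norm_neg, norm_mul, norm_pow]
    exact (summable_geometric_of_lt_one (norm_nonneg q) hq).mul_left _
  simpa [sub_eq_add_neg] using multipliable_one_add_of_summable h

/-- The expression `(q/a; q)_n a^n`. At `a = 0` it takes its limiting value
`(-1)^n q^{n(n+1)/2}`. -/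
noncomputable def qPochDivMulPow (a q : ℂ) (n : ℕ) : ℂ :=
  if a = 0 then (-1) ^ n * q ^ (n * (n + 1) / 2) else qPoch (q / a) q n * a ^ n

/-- `(q/a; q)_n a^n = ∏_{k=1}^{n} (a - q^k)`, a polynomial in `a`. -/
theorem qPochDivMulPow_eq_prod (a q : ℂ) (n : ℕ) :
    qPochDivMulPow a q n = ∏ k ∈ Finset.range n, (a - q ^ (k + 1)) := by
  unfold qPochDivMulPow
  split_ifs with h
  · subst h
    have h1 : n * (n + 1) / 2 = ∑ k ∈ Finset.range n, (k + 1) := by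
      have h2 := Finset.sum_range_id (n + 1)
      rw [Finset.sum_range_succ'] at h2
      simp only [add_zero, Nat.add_sub_cancel] at h2
      rw [h2, mul_comm]
    rw [h1, ← Finset.prod_pow_eq_pow_sum]
    simp [Finset.prod_neg]
  · unfold qPoch
    rw [Finset.pow_eq_prod_const, ← Finset.prod_mul_distrib]
    refine Finset.prod_congr rfl fun k _ => ?_
    field_simp
    ring

/-- The value at `a = 0` is the limit of `(q/a; q)_n a^n` as `a → 0`. -/
theorem continuous_qPochDivMulPow (q : ℂ) (n : ℕ) :
    Continuous (fun a => qPochDivMulPow a q n) := by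
  simp only [qPochDivMulPow_eq_prod]
  fun_prop

/-- The finite theta function `T_n(q) = ∑_{j=0}^n q^{-j(j+1)/2}`. -/
noncomputable def thetaT (q : ℂ) (n : ℕ) : ℂ :=
  ∑ j ∈ Finset.range (n + 1), q ^ (-((j * (j + 1) / 2 : ℕ) : ℤ))

/-- The term `(-q; q)_n² (q/a, q/b; q)_n (ab/q)^n / (q; q)_{2n}`. -/
noncomputable def lhsTermF (a b q : ℂ) (n : ℕ) : ℂ :=
  qPoch (-q) q n ^ 2 * (qPochDivMulPow a q n * qPochDivMulPow b q n / q ^ n)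
    / qPoch q q (2 * n)

/-- The term `(q/a, q/b; q)_n (ab/q)^n / (q; q²)_n`. -/
noncomputable def lhsTermG (a b q : ℂ) (n : ℕ) : ℂ :=
  (qPochDivMulPow a q n * qPochDivMulPow b q n / q ^ n) / qPoch q (q ^ 2) n

/-- With `m = n + 1` and a sign `ε`, the term
`(1 + q^m) (q/a, q/b; q)_m (ε ab)^m / (a, b; q)_m · q^{m² - 2m} (q^m T_m(q) - T_{m-1}(q))`.
Thus `n = 0, 1, 2, …` runs through `m = 1, 2, 3, …`. -/
noncomputable def rhsTerm (ε a b q : ℂ) (n : ℕ) : ℂ :=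
  (1 + q ^ (n + 1))
    * (ε ^ (n + 1) * (qPochDivMulPow a q (n + 1) * qPochDivMulPow b q (n + 1))
        / (qPoch a q (n + 1) * qPoch b q (n + 1)))
    * q ^ (((n + 1 : ℕ) : ℤ) ^ 2 - 2 * ((n + 1 : ℕ) : ℤ))
    * (q ^ (n + 1) * thetaT q (n + 1) - thetaT q n)

/-! Both identities are Bailey's lemma relative to 1, applied to one explicit α carrying a sign ε.
Two ingredients are needed.

Bailey's lemma: insert the definition of β into the weighted sum and interchange summations. The
inner sum over n is then a q-Gauss series (`qGauss`). That sum follows from a telescoping contiguous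
relation, iterated until only the zeroth term survives in the limit.

The pairs: β_n has the value (-q; q)_n² / (q; q)_{2n} for ε = 1 and 1 / (q; q²)_n for ε = -1. Each
follows from a first-order recurrence in n, proved by creative telescoping
(`sum_thetaAlpha_mul_kernel_eq_zero`). The partial sums are not free of T_m, but they are linear in
it, so a pair of rational certificates suffices. -/

open Filter Topology

/-- A form of the ratio test: a sequence whose successive ratios tend to a limit of norm `< 1`
is summable. -/
theorem summable_of_ratio_tendsto {t ρ : ℕ → ℂ} {L : ℂ} (h : ∀ m, t (m + 1) = ρ m * t m)
    (hρ : Tendsto ρ atTop (𝓝 L)) (hL : ‖L‖ < 1) : Summable t := by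
  obtain ⟨s, hs, hs1⟩ := exists_between hL
  refine summable_of_ratio_norm_eventually_le hs1 ?_
  filter_upwards [hρ.norm.eventually_lt_const hs] with m hm
  rw [h, norm_mul]
  gcongr

/-! ### Finite and infinite q-shifted factorials -/

theorem one_sub_pow_succ_ne_zero {q : ℂ} (hq : ‖q‖ < 1) (k : ℕ) : 1 - q ^ (k + 1) ≠ 0 := by
  intro h
  have h1 : ‖q ^ (k + 1)‖ < 1 := by
    rw [norm_pow]
    exact pow_lt_one₀ (norm_nonneg q) hq (Nat.succ_ne_zero k)
  rw [← sub_eq_zero.mp h, norm_one] at h1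
  exact lt_irrefl _ h1

theorem one_add_pow_succ_ne_zero {q : ℂ} (hq : ‖q‖ < 1) (k : ℕ) : 1 + q ^ (k + 1) ≠ 0 := by
  intro h
  refine one_sub_pow_succ_ne_zero hq (2 * k + 1) ?_
  have h1 : q ^ (2 * k + 1 + 1) = q ^ (k + 1) * q ^ (k + 1) := by ring
  rw [h1]
  linear_combination (1 - q ^ (k + 1)) * h

theorem qPoch_zero (a q : ℂ) : qPoch a q 0 = 1 := by simp [qPoch]

theorem qPoch_succ (a q : ℂ) (n : ℕ) : qPoch a q (n + 1) = qPoch a q n * (1 - a * q ^ n) :=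
  Finset.prod_range_succ _ _

theorem qPoch_self_succ (q : ℂ) (n : ℕ) :
    qPoch q q (n + 1) = qPoch q q n * (1 - q ^ (n + 1)) := by
  rw [qPoch_succ, pow_succ']

theorem qPoch_self_ne_zero {q : ℂ} (hq : ‖q‖ < 1) (n : ℕ) : qPoch q q n ≠ 0 := by
  refine Finset.prod_ne_zero_iff.mpr fun k _ => ?_
  rw [← pow_succ']
  exact one_sub_pow_succ_ne_zero hq k

theorem tendsto_qPoch (a : ℂ) {q : ℂ} (hq : ‖q‖ < 1) :
    Tendsto (qPoch a q) atTop (𝓝 (qPochInf a q)) :=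
  (multipliable_qPochInf a q hq).tendsto_prod_tprod_nat

theorem qPochInf_ne_zero {a q : ℂ} (hq : ‖q‖ < 1) (ha : ∀ k : ℕ, a * q ^ k ≠ 1) :
    qPochInf a q ≠ 0 := by
  have h := tprod_one_add_ne_zero_of_summable (f := fun k : ℕ => -(a * q ^ k))
    (fun k => by simpa [← sub_eq_add_neg] using sub_ne_zero.mpr (ha k).symm)
    (by
      simp only [norm_neg, norm_mul, norm_pow]
      exact (summable_geometric_of_lt_one (norm_nonneg q) hq).mul_left _)
  simpa [qPochInf, sub_eq_add_neg] using h

theorem qPochInf_self_ne_zero {q : ℂ} (hq : ‖q‖ < 1) : qPochInf q q ≠ 0 :=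
  qPochInf_ne_zero hq fun k h => one_sub_pow_succ_ne_zero hq k (by rw [pow_succ', h, sub_self])

theorem qPoch_mul_qPochInf (a : ℂ) {q : ℂ} (hq : ‖q‖ < 1) (n : ℕ) :
    qPoch a q n * qPochInf (a * q ^ n) q = qPochInf a q := by
  have h1 : Tendsto (fun m => qPoch a q (m + n)) atTop (𝓝 (qPochInf a q)) :=
    (tendsto_add_atTop_iff_nat n).mpr (tendsto_qPoch a hq)
  have h2 := (tendsto_qPoch (a * q ^ n) hq).const_mul (qPoch a q n)
  refine tendsto_nhds_unique (h2.congr fun m => ?_) h1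
  rw [add_comm m n, qPoch, qPoch, qPoch, Finset.prod_range_add]
  simp only [pow_add, mul_assoc]

theorem exists_norm_inv_qPoch_self_le {q : ℂ} (hq : ‖q‖ < 1) :
    ∃ C : ℝ, 0 ≤ C ∧ ∀ n, ‖(qPoch q q n)⁻¹‖ ≤ C := by
  have h := ((tendsto_qPoch q hq).inv₀ (qPochInf_self_ne_zero hq)).norm
  obtain ⟨C, hC⟩ := h.bddAbove_range
  exact ⟨C, (norm_nonneg _).trans (hC ⟨0, rfl⟩), fun n => hC ⟨n, rfl⟩⟩

/-! ### The q-Gauss sum -/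

/-- The numerator of the `m`-th term of the `q`-Gauss series, in the form
`∏_{k<m} (u - q^{d+1+k}) (v - q^{d+1+k}) / q^{(d+1)m}`. -/
noncomputable def gaussNum (u v q : ℂ) (d m : ℕ) : ℂ :=
  ∏ k ∈ Finset.range m, (u - q ^ (d + 1 + k)) * (v - q ^ (d + 1 + k)) / q ^ (d + 1)

/-- The `m`-th term of the `q`-Gauss series with denominator parameter `q^{d+1}`, divided by
`(q; q)_d`. -/
noncomputable def gaussTerm (u v q : ℂ) (d m : ℕ) : ℂ :=
  gaussNum u v q d m / (qPoch q q m * qPoch q q (d + m))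

theorem gaussNum_succ (u v q : ℂ) (d m : ℕ) :
    gaussNum u v q d (m + 1) =
      (u - q ^ (d + 1 + m)) * (v - q ^ (d + 1 + m)) / q ^ (d + 1) * gaussNum u v q d m := by
  rw [gaussNum, Finset.prod_range_succ, mul_comm, gaussNum]

theorem summable_gaussNum {u v q : ℂ} (hq : ‖q‖ < 1) (d : ℕ)
    (hz : ‖u * v / q ^ (d + 1)‖ < 1) : Summable (gaussNum u v q d) := by
  refine summable_of_ratio_tendsto (gaussNum_succ u v q d) (L := u * v / q ^ (d + 1)) ?_ hz
  have h : Tendsto (fun m : ℕ => q ^ (d + 1 + m)) atTop (𝓝 0) := by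
    have := (tendsto_pow_atTop_nhds_zero_of_norm_lt_one hq).const_mul (q ^ (d + 1))
    simpa [pow_add] using this
  have h2 := ((h.const_sub u).mul (h.const_sub v)).div_const (q ^ (d + 1))
  simpa using h2

theorem summable_gaussTerm {u v q : ℂ} (hq : ‖q‖ < 1) (d : ℕ)
    (hz : ‖u * v / q ^ (d + 1)‖ < 1) : Summable (gaussTerm u v q d) := by
  obtain ⟨C, hC0, hC⟩ := exists_norm_inv_qPoch_self_le hq
  refine Summable.of_norm_bounded (((summable_gaussNum hq d hz).norm).mul_right (C * C)) fun m => ?_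
  rw [gaussTerm, div_eq_mul_inv, mul_inv, norm_mul, norm_mul]
  gcongr
  · exact hC _
  · exact hC _

/-- Each factor of the product scales by q^{2N} / q^N = q^N. This decay isolates the term m = 0 as N
→ ∞. -/
theorem gaussNum_mul_pow {q : ℂ} (hq0 : q ≠ 0) (u v : ℂ) (d N m : ℕ) :
    gaussNum (u * q ^ N) (v * q ^ N) q (d + N) m = (q ^ N) ^ m * gaussNum u v q d m := by
  induction m with
  | zero => simp [gaussNum]
  | succ m ih =>
    rw [gaussNum_succ, gaussNum_succ, ih]
    have h1 : q ^ (d + N + 1 + m) = q ^ N * q ^ (d + 1 + m) := by ring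
    have h2 : q ^ (d + N + 1) = q ^ N * q ^ (d + 1) := by ring
    rw [h1, h2]
    field_simp
    ring

/-- Contiguous relation raising the denominator parameter q^{d+1} to q^{d+2} while the numerator
parameters q^{d+1}/u and q^{d+1}/v stay fixed. The right side is G_m - G_{m+1} with G_0 = 0. -/
theorem gaussTerm_telescope {q : ℂ} (hq0 : q ≠ 0) (hq : ‖q‖ < 1) (u v : ℂ) (d m : ℕ) :
    (1 - u * v / q ^ (d + 1)) * gaussTerm u v q d m
        - (1 - u) * (1 - v) * gaussTerm (u * q) (v * q) q (d + 1) m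
      = (1 - q ^ m) * gaussTerm u v q d m
        - (1 - q ^ (m + 1)) * gaussTerm u v q d (m + 1) := by
  have h := gaussNum_mul_pow hq0 u v d 1 m
  rw [pow_one] at h
  simp only [gaussTerm, h, gaussNum_succ, ← add_assoc, qPoch_self_succ]
  rw [show d + 1 + m = d + m + 1 by ring, qPoch_self_succ]
  have h1 := qPoch_self_ne_zero hq m
  have h2 := qPoch_self_ne_zero hq (d + m)
  have h3 := one_sub_pow_succ_ne_zero hq m
  have h4 := one_sub_pow_succ_ne_zero hq (d + m)
  have h5 : q ^ (d + m + 1) = q ^ (d + 1) * q ^ m := by ring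
  rw [h5] at h4 ⊢
  have h6 : q ^ (d + 1) ≠ 0 := pow_ne_zero _ hq0
  generalize q ^ (d + 1) = c at *
  generalize q ^ (m + 1) = M' at *
  generalize q ^ m = M at *
  field_simp
  ring

theorem tsum_gaussTerm_step {u v q : ℂ} (hq0 : q ≠ 0) (hq : ‖q‖ < 1) (d : ℕ)
    (hz : ‖u * v / q ^ (d + 1)‖ < 1) :
    (1 - u * v / q ^ (d + 1)) * ∑' m, gaussTerm u v q d m
      = (1 - u) * (1 - v) * ∑' m, gaussTerm (u * q) (v * q) q (d + 1) m := by
  have hs := summable_gaussTerm hq d hz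
  have hs' : Summable (gaussTerm (u * q) (v * q) q (d + 1)) := by
    refine summable_gaussTerm hq (d + 1) ?_
    have h : u * q * (v * q) / q ^ (d + 1 + 1) = q * (u * v / q ^ (d + 1)) := by
      field_simp
      ring
    rw [h, norm_mul]
    exact mul_lt_one_of_nonneg_of_lt_one_left (norm_nonneg _) hq hz.le
  have hG : Summable fun m => (1 - q ^ m) * gaussTerm u v q d m := by
    refine Summable.of_norm_bounded (hs.norm.mul_left 2) fun m => ?_
    rw [norm_mul]
    gcongr
    refine (norm_sub_le _ _).trans ?_
    rw [norm_one, norm_pow]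
    linarith [pow_le_one₀ (n := m) (norm_nonneg q) hq.le]
  have hG' := (summable_nat_add_iff 1).mpr hG
  rw [← sub_eq_zero, ← tsum_mul_left, ← tsum_mul_left,
    ← (hs.mul_left _).tsum_sub (hs'.mul_left _)]
  simp only [gaussTerm_telescope hq0 hq]
  rw [hG.tsum_sub hG', hG.tsum_eq_zero_add]
  simp

theorem tsum_gaussTerm_iterate {u v q : ℂ} (hq0 : q ≠ 0) (hq : ‖q‖ < 1) (d : ℕ)
    (hz : ‖u * v / q ^ (d + 1)‖ < 1) (N : ℕ) :
    qPoch (u * v / q ^ (d + 1)) q N * ∑' m, gaussTerm u v q d m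
      = qPoch u q N * qPoch v q N
        * ∑' m, gaussTerm (u * q ^ N) (v * q ^ N) q (d + N) m := by
  induction N with
  | zero => simp [qPoch_zero]
  | succ N ih =>
    have hzN : u * q ^ N * (v * q ^ N) / q ^ (d + N + 1) = u * v / q ^ (d + 1) * q ^ N := by
      field_simp
      ring
    have hstep := tsum_gaussTerm_step (u := u * q ^ N) (v := v * q ^ N) hq0 hq (d + N) (by
      rw [hzN, norm_mul, norm_pow]
      exact mul_lt_one_of_nonneg_of_lt_one_left (norm_nonneg _) hz
        (pow_le_one₀ (norm_nonneg q) hq.le))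
    rw [hzN] at hstep
    rw [qPoch_succ, qPoch_succ, qPoch_succ, pow_succ q N, ← mul_assoc u, ← mul_assoc v, ← add_assoc]
    linear_combination (1 - u * v / q ^ (d + 1) * q ^ N) * ih + qPoch u q N * qPoch v q N * hstep

/-- Dominated convergence: the factor q^{Nm} kills every term with m ≥ 1, and the term m = 0 is 1 /
(q; q)_{d+N}. -/
theorem tendsto_tsum_gaussTerm {u v q : ℂ} (hq0 : q ≠ 0) (hq : ‖q‖ < 1) (d : ℕ)
    (hz : ‖u * v / q ^ (d + 1)‖ < 1) :
    Tendsto (fun N : ℕ => ∑' m, gaussTerm (u * q ^ N) (v * q ^ N) q (d + N) m) atTop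
      (𝓝 (qPochInf q q)⁻¹) := by
  obtain ⟨C, hC0, hC⟩ := exists_norm_inv_qPoch_self_le hq
  have hlim : (qPochInf q q)⁻¹ = ∑' m : ℕ, if m = 0 then (qPochInf q q)⁻¹ else 0 := by
    rw [tsum_ite_eq]
  rw [hlim]
  refine tendsto_tsum_of_dominated_convergence
    (((summable_gaussNum hq d hz).norm).mul_right (C * C)) (fun m => ?_)
    (Eventually.of_forall fun N m => ?_)
  · have hinv : Tendsto (fun N : ℕ => (qPoch q q (d + N + m))⁻¹) atTop (𝓝 (qPochInf q q)⁻¹) := by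
      have h := ((tendsto_add_atTop_iff_nat (d + m)).mpr (tendsto_qPoch q hq)).inv₀
        (qPochInf_self_ne_zero hq)
      refine h.congr fun N => ?_
      rw [show N + (d + m) = d + N + m by ring]
    have hpow : Tendsto (fun N : ℕ => (q ^ N) ^ m) atTop (𝓝 (if m = 0 then 1 else 0)) := by
      split_ifs with h
      · simp [h]
      · have h1 := (tendsto_pow_atTop_nhds_zero_of_norm_lt_one hq).pow m
        rwa [zero_pow h] at h1
    have h := (hpow.mul_const (gaussNum u v q d m * (qPoch q q m)⁻¹)).mul hinv
    have h0 : (if m = 0 then (1 : ℂ) else 0) * (gaussNum u v q d m * (qPoch q q m)⁻¹)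
        * (qPochInf q q)⁻¹ = if m = 0 then (qPochInf q q)⁻¹ else 0 := by
      split_ifs with h
      · simp [h, gaussNum, qPoch_zero]
      · simp
    rw [h0] at h
    refine h.congr fun N => ?_
    rw [gaussTerm, gaussNum_mul_pow hq0, div_eq_mul_inv, mul_inv]
    ring
  · rw [gaussTerm, gaussNum_mul_pow hq0, div_eq_mul_inv, mul_inv, norm_mul, norm_mul, norm_mul]
    have h1 : ‖(q ^ N) ^ m‖ ≤ 1 := by
      rw [norm_pow, norm_pow]
      exact pow_le_one₀ (by positivity) (pow_le_one₀ (norm_nonneg q) hq.le)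
    have h2 : ‖(q ^ N) ^ m‖ * ‖gaussNum u v q d m‖ ≤ ‖gaussNum u v q d m‖ :=
      mul_le_of_le_one_left (norm_nonneg _) h1
    gcongr
    · exact hC _
    · exact hC _

/-- Heine's `q`-analogue of Gauss's summation theorem. -/
theorem qGauss {u v q : ℂ} (hq0 : q ≠ 0) (hq : ‖q‖ < 1) (d : ℕ)
    (hz : ‖u * v / q ^ (d + 1)‖ < 1) :
    qPochInf q q * qPochInf (u * v / q ^ (d + 1)) q * ∑' m, gaussTerm u v q d m
      = qPochInf u q * qPochInf v q := by
  have h1 := (tendsto_qPoch (u * v / q ^ (d + 1)) hq).mul_const (∑' m, gaussTerm u v q d m)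
  have h2 := ((tendsto_qPoch u hq).mul (tendsto_qPoch v hq)).mul
    (tendsto_tsum_gaussTerm hq0 hq d hz)
  have h3 := tendsto_nhds_unique (h1.congr (tsum_gaussTerm_iterate hq0 hq d hz)) h2
  rw [mul_assoc, h3]
  field_simp [qPochInf_self_ne_zero hq]

/-! ### Bailey's lemma relative to 1 -/

/-- The factor `(q/a, q/b; q)_n (ab/q)^n`. -/
noncomputable def baileyWeight (a b q : ℂ) (n : ℕ) : ℂ :=
  qPochDivMulPow a q n * qPochDivMulPow b q n / q ^ n

theorem qPochDivMulPow_succ (a q : ℂ) (n : ℕ) :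
    qPochDivMulPow a q (n + 1) = qPochDivMulPow a q n * (a - q ^ (n + 1)) := by
  rw [qPochDivMulPow_eq_prod, qPochDivMulPow_eq_prod, Finset.prod_range_succ]

theorem baileyWeight_zero (a b q : ℂ) : baileyWeight a b q 0 = 1 := by
  simp [baileyWeight, qPochDivMulPow_eq_prod]

theorem baileyWeight_succ (a b q : ℂ) (n : ℕ) :
    baileyWeight a b q (n + 1)
      = (a - q ^ (n + 1)) * (b - q ^ (n + 1)) / q * baileyWeight a b q n := by
  rw [baileyWeight, baileyWeight, qPochDivMulPow_succ, qPochDivMulPow_succ, pow_succ q n]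
  simp only [div_eq_mul_inv, mul_inv]
  ring

theorem summable_baileyWeight {a b q : ℂ} (hq : ‖q‖ < 1) (hab : ‖a * b / q‖ < 1) :
    Summable (baileyWeight a b q) := by
  refine summable_of_ratio_tendsto (baileyWeight_succ a b q) (L := a * b / q) ?_ hab
  have h := (tendsto_add_atTop_iff_nat 1).mpr (tendsto_pow_atTop_nhds_zero_of_norm_lt_one hq)
  simpa using ((h.const_sub a).mul (h.const_sub b)).div_const q

theorem baileyWeight_add {q : ℂ} (hq0 : q ≠ 0) (a b : ℂ) (r m : ℕ) :
    baileyWeight a b q (m + r)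
      = baileyWeight a b q r * gaussNum (a * q ^ r) (b * q ^ r) q (2 * r) m := by
  induction m with
  | zero => simp [gaussNum]
  | succ m ih =>
    rw [show m + 1 + r = m + r + 1 by ring, baileyWeight_succ, gaussNum_succ, ih]
    have h1 : q ^ (2 * r + 1 + m) = q ^ r * q ^ (m + r + 1) := by ring
    have h2 : q ^ (2 * r + 1) = q ^ r * q ^ r * q := by ring
    rw [h1, h2]
    field_simp

/-- The summand of the double series obtained by inserting the defining sum of a Bailey pair
relative to `1`. -/
noncomputable def baileyDouble (a b q : ℂ) (α : ℕ → ℂ) (n r : ℕ) : ℂ :=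
  if r ≤ n then α r * (baileyWeight a b q n / (qPoch q q (n - r) * qPoch q q (n + r))) else 0

/-- The factors 1 / (q; q)_k are uniformly bounded, so a product of two summable sequences
dominates; this justifies the interchange. -/
theorem summable_baileyDouble {a b q : ℂ} (hq : ‖q‖ < 1) (hab : ‖a * b / q‖ < 1)
    {α : ℕ → ℂ} (hα : Summable α) :
    Summable fun p : ℕ × ℕ => baileyDouble a b q α p.1 p.2 := by
  obtain ⟨C, hC0, hC⟩ := exists_norm_inv_qPoch_self_le hq
  have h := ((summable_baileyWeight hq hab).norm.mul_right (C * C)).mul_of_nonneg hα.norm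
    (fun n => by positivity) fun n => norm_nonneg _
  refine Summable.of_norm_bounded h fun p => ?_
  rw [baileyDouble]
  split_ifs
  · rw [div_eq_mul_inv, mul_inv, norm_mul, norm_mul, norm_mul, mul_comm]
    gcongr
    · exact hC _
    · exact hC _
  · rw [norm_zero]
    positivity

/-- With n = m + r the sum is q-Gauss at u = a q^r, v = b q^r, d = 2r. Its argument uv / q^{2r+1} =
ab/q does not depend on r, so the prefactor is common to all r. -/
theorem tsum_baileyDouble_left {a b q : ℂ} (hq0 : q ≠ 0) (hq : ‖q‖ < 1)
    (hab : ‖a * b / q‖ < 1) (ha : ∀ k : ℕ, a * q ^ k ≠ 1) (hb : ∀ k : ℕ, b * q ^ k ≠ 1)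
    (α : ℕ → ℂ) (r : ℕ) :
    qPochInf q q * qPochInf (a * b / q) q / (qPochInf a q * qPochInf b q)
        * ∑' n, baileyDouble a b q α n r
      = α r * (baileyWeight a b q r / (qPoch a q r * qPoch b q r)) := by
  have hinj : Function.Injective fun m : ℕ => m + r := add_left_injective r
  have hsupp : Function.support (fun n => baileyDouble a b q α n r)
      ⊆ Set.range fun m : ℕ => m + r := by
    intro n hn
    by_cases h : r ≤ n
    · exact ⟨n - r, Nat.sub_add_cancel h⟩
    · exact absurd (if_neg h) hn
  have hterm : ∀ m, baileyDouble a b q α (m + r) r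
      = α r * baileyWeight a b q r * gaussTerm (a * q ^ r) (b * q ^ r) q (2 * r) m := by
    intro m
    rw [baileyDouble, if_pos (Nat.le_add_left r m), baileyWeight_add hq0, gaussTerm,
      Nat.add_sub_cancel, show m + r + r = 2 * r + m by ring]
    ring
  have hz : a * q ^ r * (b * q ^ r) / q ^ (2 * r + 1) = a * b / q := by
    field_simp
    ring
  have hG := qGauss (u := a * q ^ r) (v := b * q ^ r) hq0 hq (2 * r) (by rwa [hz])
  rw [hz] at hG
  rw [← hinj.tsum_eq hsupp]
  simp only [hterm]
  rw [tsum_mul_left]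
  have ha0 := qPochInf_ne_zero hq ha
  have hb0 := qPochInf_ne_zero hq hb
  rw [← qPoch_mul_qPochInf a hq r] at ha0 ⊢
  rw [← qPoch_mul_qPochInf b hq r] at hb0 ⊢
  have ha1 := left_ne_zero_of_mul ha0
  have ha2 := right_ne_zero_of_mul ha0
  have hb1 := left_ne_zero_of_mul hb0
  have hb2 := right_ne_zero_of_mul hb0
  field_simp
  linear_combination α r * baileyWeight a b q r * hG

/-- Bailey's lemma relative to `1`: if `β_n = ∑_{r ≤ n} α_r / ((q; q)_{n-r} (q; q)_{n+r})` and
`∑ α_r` converges absolutely, the two weighted series converge and are proportional. -/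
theorem bailey_lemma {a b q : ℂ} (hq0 : q ≠ 0) (hq : ‖q‖ < 1) (hab : ‖a * b / q‖ < 1)
    (ha : ∀ k : ℕ, a * q ^ k ≠ 1) (hb : ∀ k : ℕ, b * q ^ k ≠ 1) {α β : ℕ → ℂ}
    (hα : Summable α)
    (hβ : ∀ n, β n
      = ∑ r ∈ Finset.range (n + 1), α r / (qPoch q q (n - r) * qPoch q q (n + r))) :
    (Summable fun n => β n * baileyWeight a b q n) ∧
    (Summable fun r => α r * (baileyWeight a b q r / (qPoch a q r * qPoch b q r))) ∧
    qPochInf q q * qPochInf (a * b / q) q / (qPochInf a q * qPochInf b q)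
        * ∑' n, β n * baileyWeight a b q n
      = ∑' r, α r * (baileyWeight a b q r / (qPoch a q r * qPoch b q r)) := by
  have hs := summable_baileyDouble hq hab hα
  have hrow : ∀ n, ∑' r, baileyDouble a b q α n r = β n * baileyWeight a b q n := by
    intro n
    rw [tsum_eq_sum (s := Finset.range (n + 1)), hβ, Finset.sum_mul]
    · refine Finset.sum_congr rfl fun r hr => ?_
      rw [baileyDouble, if_pos (Nat.lt_succ_iff.mp (Finset.mem_range.mp hr))]
      ring
    · intro r hr
      exact if_neg fun h => hr (Finset.mem_range.mpr (Nat.lt_succ_of_le h))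
  have hcol := tsum_baileyDouble_left hq0 hq hab ha hb α
  have hs1 := hs.prod
  have hs2 := (hs.prod_symm.prod).mul_left
    (qPochInf q q * qPochInf (a * b / q) q / (qPochInf a q * qPochInf b q))
  simp only [Prod.swap_prod_mk, hcol] at hs2
  simp only [hrow] at hs1
  refine ⟨hs1, hs2, ?_⟩
  have hcomm : ∑' n, ∑' r, baileyDouble a b q α n r = ∑' r, ∑' n, baileyDouble a b q α n r :=
    (Summable.tsum_comm (f := baileyDouble a b q α) hs).symm
  rw [← tsum_congr hrow, hcomm, ← tsum_mul_left]
  exact tsum_congr hcol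

/-! ### The sequence α and its summability -/

/-- The sequence `α_0 = 1`, `α_n = ε^n (1 + q^n) q^{n² - n} (q^n T_n(q) - T_{n-1}(q))`. -/
noncomputable def thetaAlpha (ε q : ℂ) : ℕ → ℂ
  | 0 => 1
  | n + 1 => ε ^ (n + 1) * (1 + q ^ (n + 1)) * (q ^ (n * (n + 1) / 2)) ^ 2
      * (q ^ (n + 1) * thetaT q (n + 1) - thetaT q n)

theorem pow_triangle_succ (q : ℂ) (n : ℕ) :
    q ^ ((n + 1) * (n + 1 + 1) / 2) = q ^ (n * (n + 1) / 2) * q ^ (n + 1) := by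
  rw [← pow_add]
  congr 1
  rw [show (n + 1) * (n + 1 + 1) = n * (n + 1) + (n + 1) * 2 by ring,
    Nat.add_mul_div_right _ _ two_pos]

theorem thetaT_succ (q : ℂ) (n : ℕ) :
    thetaT q (n + 1) = thetaT q n + (q ^ ((n + 1) * (n + 1 + 1) / 2))⁻¹ := by
  rw [thetaT, Finset.sum_range_succ, ← thetaT, zpow_neg, zpow_natCast]

theorem thetaT_zero (q : ℂ) : thetaT q 0 = 1 := by simp [thetaT]

/-- The product x_n satisfies x_{n+1} = q^{n+1} x_n + 1, and the bound is the fixed point of x ↦ ‖q‖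
x + 1. -/
theorem norm_pow_triangle_mul_thetaT_le {q : ℂ} (hq0 : q ≠ 0) (hq : ‖q‖ < 1) (n : ℕ) :
    ‖q ^ (n * (n + 1) / 2) * thetaT q n‖ ≤ (1 - ‖q‖)⁻¹ := by
  have h1 : 0 < 1 - ‖q‖ := by linarith
  induction n with
  | zero =>
    rw [thetaT_zero]
    simpa using (one_le_inv₀ h1).mpr (by linarith [norm_nonneg q])
  | succ n ih =>
    have h2 : q ^ ((n + 1) * (n + 1 + 1) / 2) ≠ 0 := pow_ne_zero _ hq0
    rw [thetaT_succ, mul_add, mul_inv_cancel₀ h2, pow_triangle_succ, mul_right_comm]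
    refine (norm_add_le _ _).trans ?_
    rw [norm_mul, norm_one, norm_pow]
    have h3 : ‖q‖ ^ (n + 1) ≤ ‖q‖ := pow_le_of_le_one (norm_nonneg q) hq.le (Nat.succ_ne_zero n)
    calc _ ≤ (1 - ‖q‖)⁻¹ * ‖q‖ + 1 := by gcongr
      _ = (1 - ‖q‖)⁻¹ := by
        field_simp
        ring

theorem summable_pow_triangle {q : ℂ} (hq : ‖q‖ < 1) :
    Summable fun n : ℕ => q ^ (n * (n + 1) / 2) := by
  refine summable_of_ratio_tendsto (ρ := fun n => q ^ (n + 1)) (L := 0) (fun n => ?_) ?_ (by simp)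
  · rw [pow_triangle_succ, mul_comm]
  · exact (tendsto_add_atTop_iff_nat 1).mpr (tendsto_pow_atTop_nhds_zero_of_norm_lt_one hq)

theorem summable_thetaAlpha {ε q : ℂ} (hε : ‖ε‖ = 1) (hq0 : q ≠ 0) (hq : ‖q‖ < 1) :
    Summable (thetaAlpha ε q) := by
  refine (summable_nat_add_iff 1).mp ?_
  refine Summable.of_norm_bounded
    ((summable_pow_triangle hq).norm.mul_right (2 * ((1 - ‖q‖)⁻¹ + (1 - ‖q‖)⁻¹))) fun n => ?_
  have h : thetaAlpha ε q (n + 1) = q ^ (n * (n + 1) / 2) * (ε ^ (n + 1) * (1 + q ^ (n + 1))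
      * (q ^ ((n + 1) * (n + 1 + 1) / 2) * thetaT q (n + 1)
        - q ^ (n * (n + 1) / 2) * thetaT q n)) := by
    rw [thetaAlpha, pow_triangle_succ]
    ring
  rw [h, norm_mul, norm_mul, norm_mul, norm_pow ε, hε, one_pow, one_mul]
  gcongr
  · refine (norm_add_le _ _).trans ?_
    rw [norm_one, norm_pow]
    linarith [pow_le_one₀ (n := n + 1) (norm_nonneg q) hq.le]
  · exact (norm_sub_le _ _).trans (add_le_add (norm_pow_triangle_mul_thetaT_le hq0 hq _)
      (norm_pow_triangle_mul_thetaT_le hq0 hq _))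

/-! ### Evaluating β by creative telescoping -/

/-- The kernel `1 / ((q; q)_{n-r} (q; q)_{n+r})` of a Bailey pair relative to `1`. -/
noncomputable def baileyKernel (q : ℂ) (n r : ℕ) : ℂ :=
  (qPoch q q (n - r) * qPoch q q (n + r))⁻¹

theorem baileyKernel_succ_right {q : ℂ} (hq0 : q ≠ 0) (hq : ‖q‖ < 1) {n r : ℕ} (h : r < n) :
    baileyKernel q n (r + 1) * (1 - q ^ n * q ^ (r + 1))
      = baileyKernel q n r * (1 - q ^ n / q ^ r) := by
  obtain ⟨k, rfl⟩ := Nat.exists_eq_add_of_lt h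
  have h1 : q ^ (r + k + 1) / q ^ r = q ^ (k + 1) := by
    field_simp
    ring
  have h2 : q ^ (r + k + 1) * q ^ (r + 1) = q ^ (r + k + 1 + r + 1) := by ring
  rw [h1, h2, baileyKernel, baileyKernel, ← add_assoc, qPoch_self_succ q (r + k + 1 + r),
    show r + k + 1 - (r + 1) = k by omega, show r + k + 1 - r = k + 1 by omega, qPoch_self_succ q k]
  have h3 := qPoch_self_ne_zero hq k
  have h4 := qPoch_self_ne_zero hq (r + k + 1 + r)
  have h5 := one_sub_pow_succ_ne_zero hq k
  have h6 := one_sub_pow_succ_ne_zero hq (r + k + 1 + r)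
  field_simp

theorem baileyKernel_succ_left {q : ℂ} (hq0 : q ≠ 0) (hq : ‖q‖ < 1) {n r : ℕ} (h : r ≤ n) :
    baileyKernel q (n + 1) r * ((1 - q ^ (n + 1) / q ^ r) * (1 - q ^ (n + 1) * q ^ r))
      = baileyKernel q n r := by
  obtain ⟨k, rfl⟩ := Nat.exists_eq_add_of_le h
  have h1 : q ^ (r + k + 1) / q ^ r = q ^ (k + 1) := by
    field_simp
    ring
  have h2 : q ^ (r + k + 1) * q ^ r = q ^ (r + k + r + 1) := by ring
  rw [h1, h2, baileyKernel, baileyKernel, show r + k + 1 + r = r + k + r + 1 by ring,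
    qPoch_self_succ q (r + k + r),
    show r + k + 1 - r = k + 1 by omega, show r + k - r = k by omega, qPoch_self_succ q k]
  have h3 := qPoch_self_ne_zero hq k
  have h4 := qPoch_self_ne_zero hq (r + k + r)
  have h5 := one_sub_pow_succ_ne_zero hq k
  have h6 := one_sub_pow_succ_ne_zero hq (r + k + r)
  field_simp

/-- The sequence `β_n = ∑_{r ≤ n} α_r / ((q; q)_{n-r} (q; q)_{n+r})` of a Bailey pair relative
to `1`. -/
noncomputable def baileyBeta (α : ℕ → ℂ) (q : ℂ) (n : ℕ) : ℂ :=
  ∑ r ∈ Finset.range (n + 1), α r * baileyKernel q n r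

/-- Puts β_n over the kernel of β_{n+1}, so that a recurrence becomes the vanishing of a single sum.
The extra term r = n + 1 has factor zero. -/
theorem sum_baileyKernel_succ {q : ℂ} (hq0 : q ≠ 0) (hq : ‖q‖ < 1) (α : ℕ → ℂ) (n : ℕ) :
    ∑ r ∈ Finset.range (n + 1 + 1), α r * baileyKernel q (n + 1) r
        * ((1 - q ^ (n + 1) / q ^ r) * (1 - q ^ (n + 1) * q ^ r))
      = baileyBeta α q n := by
  rw [Finset.sum_range_succ, div_self (pow_ne_zero _ hq0), baileyBeta]
  simp only [sub_self, zero_mul, mul_zero, add_zero]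
  refine Finset.sum_congr rfl fun r hr => ?_
  rw [mul_assoc, baileyKernel_succ_left hq0 hq (Nat.lt_succ_iff.mp (Finset.mem_range.mp hr))]

/-- Creative telescoping for sums of `thetaAlpha` against the Bailey kernel: `g` and `h` certify
that the sum with the extra factor `p (q^r)` vanishes. -/
theorem sum_thetaAlpha_mul_kernel_eq_zero {ε q : ℂ} (hq0 : q ≠ 0) (hq : ‖q‖ < 1) (n : ℕ)
    {p g h : ℂ → ℂ}
    (hg : ∀ Q : ℂ, Q ≠ 0 →
      g Q * (1 - q ^ n * Q) - ε * g (q * Q) * Q ^ 2 * (1 - q ^ n / Q) = (Q ^ 2 - 1) * p Q)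
    (hh : ∀ Q : ℂ, Q ≠ 0 →
      h Q * (1 - q ^ n * Q) - ε * h (q * Q) * Q * (1 - q ^ n / Q)
        = (1 + Q) * p Q + ε * g (q * Q) * Q * (1 - q ^ n / Q))
    (h0 : p 1 = -(ε * (g q + h q) * (1 - q ^ n))) :
    ∑ r ∈ Finset.range (n + 1), thetaAlpha ε q r * baileyKernel q n r * p (q ^ r) = 0 := by
  -- In the induction step, `hg` matches the coefficients of T_m and `hh` the rest, including what
  -- T_{m+1} - T_m contributes through g. At m = n the factor 1 - q^n / q^m vanishes.
  have key : ∀ m, m ≤ n →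
      ∑ r ∈ Finset.range (m + 1), thetaAlpha ε q r * baileyKernel q n r * p (q ^ r)
        = -(ε ^ (m + 1) * ((q ^ (m * (m + 1) / 2)) ^ 2 * g (q ^ (m + 1)) * thetaT q m
            + q ^ (m * (m + 1) / 2) * h (q ^ (m + 1)))
          * (baileyKernel q n m * (1 - q ^ n / q ^ m))) := by
    intro m
    induction m with
    | zero =>
      intro _
      simp [thetaAlpha, thetaT_zero, h0]
      ring
    | succ m ih =>
      intro hm
      rw [Finset.sum_range_succ, ih (Nat.le_of_succ_le hm), ← baileyKernel_succ_right hq0 hq hm,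
        thetaAlpha, thetaT_succ, pow_triangle_succ, pow_succ' q (m + 1)]
      have hQ : q ^ (m + 1) ≠ 0 := pow_ne_zero _ hq0
      have ht : q ^ (m * (m + 1) / 2) ≠ 0 := pow_ne_zero _ hq0
      have h1 := hg _ hQ
      have h2 := hh _ hQ
      have h3 := mul_inv_cancel₀ (mul_ne_zero ht hQ)
      generalize baileyKernel q n (m + 1) = w
      generalize thetaT q m = T
      rw [pow_succ ε (m + 1)]
      generalize ε ^ (m + 1) = e
      generalize (q ^ (m * (m + 1) / 2) * q ^ (m + 1))⁻¹ = s at *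
      generalize q ^ (m * (m + 1) / 2) = t at *
      generalize q ^ (m + 1) = Q at *
      linear_combination -(e * w * t ^ 2 * T) * h1 - e * w * t * h2
        + e * w * t * ((1 + Q) * p Q + ε * g (q * Q) * Q * (1 - q ^ n / Q)) * h3
  rw [key n le_rfl, div_self (pow_ne_zero _ hq0)]
  simp

theorem baileyBeta_thetaAlpha_one_succ {q : ℂ} (hq0 : q ≠ 0) (hq : ‖q‖ < 1) (n : ℕ) :
    (1 - q ^ (2 * n + 1)) * (1 - q ^ (n + 1)) * baileyBeta (thetaAlpha 1 q) q (n + 1)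
      = (1 + q ^ (n + 1)) * baileyBeta (thetaAlpha 1 q) q n := by
  have hN : q ^ (2 * n + 1) = q ^ (n + 1) * q ^ (n + 1) / q := by
    field_simp
    ring
  have h := sum_thetaAlpha_mul_kernel_eq_zero (ε := 1) hq0 hq (n + 1)
    -- p is the difference of the two sides of the recurrence over the common kernel; g and h are
    -- Laurent polynomials in Q.
    (p := fun Q => (1 - q ^ (2 * n + 1)) * (1 - q ^ (n + 1))
      - (1 + q ^ (n + 1)) * ((1 - q ^ (n + 1) / Q) * (1 - q ^ (n + 1) * Q)))
    (g := fun Q => -(q ^ (n + 1) * (1 + q ^ (n + 1))) / Q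
      + 2 * q ^ (n + 1) * (1 + q ^ (n + 1) / q) - q ^ (n + 1) * (1 + q ^ (n + 1)) * Q / q)
    (h := fun Q => q ^ (n + 1) * (1 + q ^ (n + 1)) / Q - q ^ (n + 1) * (1 + q ^ (n + 1) / q))
    (fun Q hQ => by
      rw [hN]
      generalize q ^ (n + 1) = N
      field_simp
      ring)
    (fun Q hQ => by
      rw [hN]
      generalize q ^ (n + 1) = N
      field_simp
      ring)
    (by
      rw [hN]
      generalize q ^ (n + 1) = N
      field_simp
      ring)
  rw [← sum_baileyKernel_succ hq0 hq _ n, ← sub_eq_zero, baileyBeta, Finset.mul_sum, Finset.mul_sum,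
    ← Finset.sum_sub_distrib, ← h]
  refine Finset.sum_congr rfl fun r _ => ?_
  ring

theorem baileyBeta_thetaAlpha_neg_one_succ {q : ℂ} (hq0 : q ≠ 0) (hq : ‖q‖ < 1) (n : ℕ) :
    (1 - q ^ (2 * n + 1)) * baileyBeta (thetaAlpha (-1) q) q (n + 1)
      = baileyBeta (thetaAlpha (-1) q) q n := by
  have hN : q ^ (2 * n + 1) = q ^ (n + 1) * q ^ (n + 1) / q := by
    field_simp
    ring
  have h1 := one_sub_pow_succ_ne_zero hq n
  have h := sum_thetaAlpha_mul_kernel_eq_zero (ε := -1) hq0 hq (n + 1)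
    (p := fun Q => (1 - q ^ (2 * n + 1)) - (1 - q ^ (n + 1) / Q) * (1 - q ^ (n + 1) * Q))
    (g := fun Q => q ^ (n + 1) * (Q / q - 1 / Q))
    -- With N = q^{n+1}, a constant c in h contributes c (1 - N)(1 + Q) to the left of `hh`, whence
    -- the denominator 1 - N.
    (h := fun Q => q ^ (n + 1) / Q
      + q ^ (n + 1) * (1 - q ^ (n + 1) / q) / (1 - q ^ (n + 1)))
    (fun Q hQ => by
      rw [hN]
      generalize q ^ (n + 1) = N
      field_simp
      ring)
    (fun Q hQ => by
      rw [hN]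
      generalize q ^ (n + 1) = N at *
      field_simp
      ring)
    (by
      rw [hN]
      generalize q ^ (n + 1) = N at *
      field_simp
      ring)
  rw [← sum_baileyKernel_succ hq0 hq _ n, ← sub_eq_zero, baileyBeta, Finset.mul_sum,
    ← Finset.sum_sub_distrib, ← h]
  refine Finset.sum_congr rfl fun r _ => ?_
  ring

theorem baileyBeta_thetaAlpha_zero (ε q : ℂ) : baileyBeta (thetaAlpha ε q) q 0 = 1 := by
  simp [baileyBeta, baileyKernel, thetaAlpha, qPoch_zero]

theorem baileyBeta_thetaAlpha_one {q : ℂ} (hq0 : q ≠ 0) (hq : ‖q‖ < 1) (n : ℕ) :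
    baileyBeta (thetaAlpha 1 q) q n = qPoch (-q) q n ^ 2 / qPoch q q (2 * n) := by
  induction n with
  | zero => simp [baileyBeta_thetaAlpha_zero, qPoch_zero]
  | succ n ih =>
    have h := baileyBeta_thetaAlpha_one_succ hq0 hq n
    have h1 := one_sub_pow_succ_ne_zero hq n
    have h2 := one_sub_pow_succ_ne_zero hq (2 * n)
    have h3 := qPoch_self_ne_zero hq (2 * n)
    have h4 := one_add_pow_succ_ne_zero hq n
    have h5 : 1 - q ^ (2 * n + 1 + 1) = (1 - q ^ (n + 1)) * (1 + q ^ (n + 1)) := by ring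
    rw [ih] at h
    rw [show 2 * (n + 1) = 2 * n + 1 + 1 by ring, qPoch_self_succ, qPoch_self_succ, qPoch_succ,
      h5, neg_mul, ← pow_succ', sub_neg_eq_add]
    generalize q ^ (n + 1) = N at *
    generalize q ^ (2 * n + 1) = M at *
    field_simp at h ⊢
    linear_combination h

theorem baileyBeta_thetaAlpha_neg_one {q : ℂ} (hq0 : q ≠ 0) (hq : ‖q‖ < 1) (n : ℕ) :
    baileyBeta (thetaAlpha (-1) q) q n = (qPoch q (q ^ 2) n)⁻¹ := by
  induction n with
  | zero => simp [baileyBeta_thetaAlpha_zero, qPoch_zero]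
  | succ n ih =>
    have h := baileyBeta_thetaAlpha_neg_one_succ hq0 hq n
    have h2 := one_sub_pow_succ_ne_zero hq (2 * n)
    rw [qPoch_succ, ← pow_mul, ← pow_succ', mul_inv, ← ih, ← h]
    field_simp

/-! ### Assembling the two identities -/

/-- Bailey's lemma for the Bailey pairs with `α = thetaAlpha ε q`. -/
theorem bailey_lemma_thetaAlpha {ε a b q : ℂ} (hε : ‖ε‖ = 1) (hq0 : q ≠ 0) (hq : ‖q‖ < 1)
    (hab : ‖a * b / q‖ < 1) (ha : ∀ k : ℕ, a * q ^ k ≠ 1) (hb : ∀ k : ℕ, b * q ^ k ≠ 1) :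
    (Summable fun n => baileyBeta (thetaAlpha ε q) q n * baileyWeight a b q n) ∧
    Summable (rhsTerm ε a b q) ∧
    qPochInf q q * qPochInf (a * b / q) q / (qPochInf a q * qPochInf b q)
        * ∑' n, baileyBeta (thetaAlpha ε q) q n * baileyWeight a b q n
      = 1 + ∑' n, rhsTerm ε a b q n := by
  obtain ⟨h1, h2, h3⟩ := bailey_lemma hq0 hq hab ha hb (summable_thetaAlpha hε hq0 hq)
    (β := baileyBeta (thetaAlpha ε q) q) fun n => rfl
  have hterm : ∀ n, thetaAlpha ε q (n + 1) * (baileyWeight a b q (n + 1)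
      / (qPoch a q (n + 1) * qPoch b q (n + 1))) = rhsTerm ε a b q n := by
    intro n
    -- With m = n + 1, the weight's factor q^{-m} turns the power q^{m² - m} in α into q^{m² - 2m}.
    have hexp : q ^ (((n + 1 : ℕ) : ℤ) ^ 2 - 2 * ((n + 1 : ℕ) : ℤ))
        = (q ^ (n * (n + 1) / 2)) ^ 2 / q ^ (n + 1) := by
      rw [← pow_mul, Nat.div_mul_cancel (Nat.even_mul_succ_self n).two_dvd, ← zpow_natCast,
        ← zpow_natCast, ← zpow_sub₀ hq0]
      congr 1
      push_cast
      ring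
    rw [thetaAlpha, rhsTerm, hexp, baileyWeight]
    ring
  refine ⟨h1, ?_, ?_⟩
  · simpa only [hterm] using (summable_nat_add_iff 1).mpr h2
  · rw [h3, h2.tsum_eq_zero_add]
    simp only [hterm]
    simp [thetaAlpha, baileyWeight_zero, qPoch_zero]

theorem mainTheorem11 (q : ℝ) (hq0 : 0 < q) (hq1 : q < 1) (a b : ℂ)
    (hab : ‖a * b / (q : ℂ)‖ < 1)
    (ha : ∀ k : ℕ, a * (q : ℂ) ^ k ≠ 1) (hb : ∀ k : ℕ, b * (q : ℂ) ^ k ≠ 1) :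
    (Summable (lhsTermF a b q) ∧ Summable (rhsTerm 1 a b q) ∧
      qPochInf q q * qPochInf (a * b / q) q / (qPochInf a q * qPochInf b q)
          * ∑' n : ℕ, lhsTermF a b q n
        = 1 + ∑' n : ℕ, rhsTerm 1 a b q n) ∧
    (Summable (lhsTermG a b q) ∧ Summable (rhsTerm (-1) a b q) ∧
      qPochInf q q * qPochInf (a * b / q) q / (qPochInf a q * qPochInf b q)
          * ∑' n : ℕ, lhsTermG a b q n
        = 1 + ∑' n : ℕ, rhsTerm (-1) a b q n) := by
  have hqC : (q : ℂ) ≠ 0 := Complex.ofReal_ne_zero.mpr hq0.ne'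
  have hqn : ‖(q : ℂ)‖ < 1 := by rwa [Complex.norm_real, Real.norm_of_nonneg hq0.le]
  have hF : lhsTermF a b q
      = fun n => baileyBeta (thetaAlpha 1 q) q n * baileyWeight a b q n := by
    funext n
    rw [baileyBeta_thetaAlpha_one hqC hqn, lhsTermF, baileyWeight]
    ring
  have hG : lhsTermG a b q
      = fun n => baileyBeta (thetaAlpha (-1) q) q n * baileyWeight a b q n := by
    funext n
    rw [baileyBeta_thetaAlpha_neg_one hqC hqn, lhsTermG, baileyWeight]
    ring
  rw [hF, hG]
  exact ⟨bailey_lemma_thetaAlpha norm_one hqC hqn hab ha hb,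
    bailey_lemma_thetaAlpha (by simp) hqC hqn hab ha hb⟩
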